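/- Let $\mathcal X\subset\mathbb R^n$ and $\mathcal Y\subset\mathbb R^d$ be nonempty, convex and compact, and let $f:\mathbb R^n\times\mathbb R^d\to\mathbb R$ be continuously differentiable such that, for some $L,\lambda>0$ and all $x,x'\in\mathcal X$, $y,y'\in\mathcal Y$, \[ \|\nabla_xf(x,y)-\nabla_xf(x',y')\|\le L(\|x-x'\|+\|y-y'\|),\qquad \|\nabla_yf(x,y)-\nabla_yf(x',y')\|\le \lambda L(\|x-x'\|+\|y-y'\|). \] Put $F(x,y,z,v)=f(x,y)+\frac{r_1}{2}\|x-z\|^2-\frac{r_2}{2}\|y-v\|^2$, where $r_1\ge 2L$ and $r_2\ge 2\lambda L$. Let $\sigma=\frac{2cr_1+1}{c(r_1-L)}$, $L_d=\left(\frac{\lambda L}{r_1-L}+2\right)\lambda L+r_2$, and let the parameters satisfy \[ 0<c\le\min\left\{\tfrac{4}{3(L+r_1)},\tfrac1{6\lambda L}\right\},\quad 0<\alpha\le\min\left\{\tfrac{2}{3\lambda L\sigma^2},\tfrac1{6L_d},\tfrac1{5\lambda\sqrt{\lambda+5}\,L}\right\}, \] \[ 0<\beta\le\min\left\{\tfrac{24r_1}{360r_1+5r_1^2\lambda+(2\lambda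 L+5r_1)^2},\tfrac{\alpha\lambda^2L^2}{384r_1(\lambda+5)(\lambda+1)^2}\right\},\quad 0<\mu\le\min\left\{\tfrac{2(\lambda+5)}{2(\lambda+5)+\lambda^2L^2},\tfrac{\alpha\lambda^2L^2}{64r_2(\lambda+5)}\right\}. \] For $z\in\mathbb R^n$ and $v\in\mathbb R^d$ let $x(z,v)=\operatorname{argmin}_{x\in\mathcal X}\max_{y\in\mathcal Y}F(x,y,z,v)$, $y(x,z,v)=\operatorname{argmax}_{y\in\mathcal Y}F(x,y,z,v)$ (for $x\in\mathcal X$), $p(z,v)=\max_{y\in\mathcal Y}\min_{x\in\mathcal X}F(x,y,z,v)$, and let $v(z)$ be any maximizer of $p(z,\cdot)$ over $\mathbb R^d$. Then $x(z,v)$ and $y(x,z,v)$ exist and are unique, and a maximizer $v(z)$ exists. For $v\in\mathbb R^d$ put $v_+(z)=v+\mu\,(y(x(z,v),z,v)-v)$. Then, for all $z\in\mathbb R^n$, $v\in\mathbb R^d$ and every choice of the maximizer $v(z)$: (i) If there are $\tau>0$ and $\theta\in(0,1)$ such that for all $x\in\mathcal X$ and $y\in\mathcal Y$ \[ \Bigl(\max_{y'\in\mathcal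 Y}f(x,y')-f(x,y)\Bigr)^{\theta}\le\frac1\tau\operatorname{dist}\bigl(0,-\nabla_yf(x,y)+N_{\mathcal Y}(y)\bigr), \] where $N_{\mathcal Y}(y)=\{u:\langle u,w-y\rangle\le 0\ \text{for all}\ w\in\mathcal Y\}$ is the normal cone, then \[ \|x(z,v_+(z))-x(z,v(z))\|^2\le\omega_0\|v_+(z)-v\|^{1/\theta},\qquad \omega_0=\frac{2}{(r_1-L)\,\tau^{1/\theta}}\left(\frac{r_2(1-\mu)}{\mu}+\frac{r_2^2}{r_2-\lambda L}\right)^{1/\theta}. \] (ii) If $f(x,\cdot)$ is concave on $\mathcal Y$ for every $x\in\mathcal X$, then \[ \|x(z,v_+(z))-x(z,v(z))\|^2\le\omega_1\|v_+(z)-v\|,\qquad \omega_1=\frac{4r_2\operatorname{diam}(\mathcal Y)}{r_1-L}\left(\frac{1-\mu}{\mu}+\frac{r_2}{r_2-\lambda L}\right). \] In particular, let $(x^t,y^t,z^t,v^t)_{t\ge 0}$ be generated from arbitrary initial points by $x^{t+1}=\operatorname{proj}_{\mathcal X}(x^t-c\nabla_xF(x^t,y^t,z^t,v^t))$, $y^{t+1}=\operatorname{proj}_{\mathcal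 Y}(y^t+\alpha\nabla_yF(x^{t+1},y^t,z^t,v^t))$, $z^{t+1}=z^t+\beta(x^{t+1}-z^t)$, $v^{t+1}=v^t+\mu(y^{t+1}-v^t)$. Then (i) and (ii) hold for every $t\ge0$ with $z=z^{t+1}$ and $v=v^t$; that is, with $v_+^t(z)=v^t+\mu\,(y(x(z,v^t),z,v^t)-v^t)$, the squared distance $\|x(z^{t+1},v_+^t(z^{t+1}))-x(z^{t+1},v(z^{t+1}))\|^2$ is at most $\omega_0\|v_+^t(z^{t+1})-v^t\|^{1/\theta}$ in case (i) and at most $\omega_1\|v_+^t(z^{t+1})-v^t\|$ in case (ii). -/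

import Mathlib

noncomputable section

/-- `f` is continuously differentiable and its two partial gradients are Lipschitz on `X × Y`,
with constants `Lx` and `Ly` (w.r.t. the sum of the Euclidean distances). -/
structure LipschitzGradient {n d : ℕ}
    (f : EuclideanSpace ℝ (Fin n) → EuclideanSpace ℝ (Fin d) → ℝ)
    (X : Set (EuclideanSpace ℝ (Fin n))) (Y : Set (EuclideanSpace ℝ (Fin d)))
    (Lx Ly : ℝ) : Prop where
  contDiff : ContDiff ℝ 1
    (fun p : EuclideanSpace ℝ (Fin n) × EuclideanSpace ℝ (Fin d) => f p.1 p.2)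
  lipschitz_x : ∀ x ∈ X, ∀ x' ∈ X, ∀ y ∈ Y, ∀ y' ∈ Y,
    ‖gradient (fun a => f a y) x - gradient (fun a => f a y') x'‖
      ≤ Lx * (‖x - x'‖ + ‖y - y'‖)
  lipschitz_y : ∀ x ∈ X, ∀ x' ∈ X, ∀ y ∈ Y, ∀ y' ∈ Y,
    ‖gradient (fun b => f x b) y - gradient (fun b => f x' b) y'‖
      ≤ Ly * (‖x - x'‖ + ‖y - y'‖)

/-- The doubly regularized function
`F(x,y,z,v) = f(x,y) + r₁/2 ‖x - z‖² - r₂/2 ‖y - v‖²`. -/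
def regF {n d : ℕ} (f : EuclideanSpace ℝ (Fin n) → EuclideanSpace ℝ (Fin d) → ℝ) (r₁ r₂ : ℝ)
    (x : EuclideanSpace ℝ (Fin n)) (y : EuclideanSpace ℝ (Fin d))
    (z : EuclideanSpace ℝ (Fin n)) (v : EuclideanSpace ℝ (Fin d)) : ℝ :=
  f x y + r₁ / 2 * ‖x - z‖ ^ 2 - r₂ / 2 * ‖y - v‖ ^ 2

/-- `d(y,z,v) = min_{x ∈ X} F(x,y,z,v)`. -/
def dualVal {n d : ℕ} (f : EuclideanSpace ℝ (Fin n) → EuclideanSpace ℝ (Fin d) → ℝ)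
    (X : Set (EuclideanSpace ℝ (Fin n))) (r₁ r₂ : ℝ)
    (y : EuclideanSpace ℝ (Fin d)) (z : EuclideanSpace ℝ (Fin n))
    (v : EuclideanSpace ℝ (Fin d)) : ℝ :=
  sInf ((fun x => regF f r₁ r₂ x y z v) '' X)

/-- `h(x,z,v) = max_{y ∈ Y} F(x,y,z,v)`. -/
def primalVal {n d : ℕ} (f : EuclideanSpace ℝ (Fin n) → EuclideanSpace ℝ (Fin d) → ℝ)
    (Y : Set (EuclideanSpace ℝ (Fin d))) (r₁ r₂ : ℝ)
    (x : EuclideanSpace ℝ (Fin n)) (z : EuclideanSpace ℝ (Fin n))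
    (v : EuclideanSpace ℝ (Fin d)) : ℝ :=
  sSup ((fun y => regF f r₁ r₂ x y z v) '' Y)

/-- `p(z,v) = max_{y ∈ Y} d(y,z,v) = max_{y ∈ Y} min_{x ∈ X} F(x,y,z,v)`. -/
def saddleVal {n d : ℕ} (f : EuclideanSpace ℝ (Fin n) → EuclideanSpace ℝ (Fin d) → ℝ)
    (X : Set (EuclideanSpace ℝ (Fin n))) (Y : Set (EuclideanSpace ℝ (Fin d))) (r₁ r₂ : ℝ)
    (z : EuclideanSpace ℝ (Fin n)) (v : EuclideanSpace ℝ (Fin d)) : ℝ :=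
  sSup ((fun y => dualVal f X r₁ r₂ y z v) '' Y)

/-- A minimizer of `g` over `S` (an arbitrary point if there is none). -/
def argminOn {E : Type*} [Nonempty E] (g : E → ℝ) (S : Set E) : E :=
  Classical.epsilon (fun a => a ∈ S ∧ IsMinOn g S a)

/-- A maximizer of `g` over `S` (an arbitrary point if there is none). -/
def argmaxOn {E : Type*} [Nonempty E] (g : E → ℝ) (S : Set E) : E :=
  Classical.epsilon (fun a => a ∈ S ∧ IsMaxOn g S a)

/-- Euclidean projection onto `S`. -/
def projOn {m : ℕ} (S : Set (EuclideanSpace ℝ (Fin m))) (u : EuclideanSpace ℝ (Fin m)) :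
    EuclideanSpace ℝ (Fin m) :=
  argminOn (fun w => ‖u - w‖) S

/-- `x(z,v) = argmin_{x ∈ X} max_{y ∈ Y} F(x,y,z,v)`. -/
def xSol {n d : ℕ} (f : EuclideanSpace ℝ (Fin n) → EuclideanSpace ℝ (Fin d) → ℝ)
    (X : Set (EuclideanSpace ℝ (Fin n))) (Y : Set (EuclideanSpace ℝ (Fin d))) (r₁ r₂ : ℝ)
    (z : EuclideanSpace ℝ (Fin n)) (v : EuclideanSpace ℝ (Fin d)) : EuclideanSpace ℝ (Fin n) :=
  argminOn (fun x => primalVal f Y r₁ r₂ x z v) X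

/-- `y(x,z,v) = argmax_{y ∈ Y} F(x,y,z,v)`. -/
def ySol {n d : ℕ} (f : EuclideanSpace ℝ (Fin n) → EuclideanSpace ℝ (Fin d) → ℝ)
    (Y : Set (EuclideanSpace ℝ (Fin d))) (r₁ r₂ : ℝ)
    (x : EuclideanSpace ℝ (Fin n)) (z : EuclideanSpace ℝ (Fin n))
    (v : EuclideanSpace ℝ (Fin d)) : EuclideanSpace ℝ (Fin d) :=
  argmaxOn (fun y => regF f r₁ r₂ x y z v) Y

/-- `v₊(z) = v + μ (y(x(z,v),z,v) - v)`. -/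
def vPlus {n d : ℕ} (f : EuclideanSpace ℝ (Fin n) → EuclideanSpace ℝ (Fin d) → ℝ)
    (X : Set (EuclideanSpace ℝ (Fin n))) (Y : Set (EuclideanSpace ℝ (Fin d))) (r₁ r₂ μ : ℝ)
    (z : EuclideanSpace ℝ (Fin n)) (v : EuclideanSpace ℝ (Fin d)) : EuclideanSpace ℝ (Fin d) :=
  v + μ • (ySol f Y r₁ r₂ (xSol f X Y r₁ r₂ z v) z v - v)

/-- `w` is a value of `v(z) = argmax_{v ∈ ℝᵈ} p(z,v)`. -/
def IsVSol {n d : ℕ} (f : EuclideanSpace ℝ (Fin n) → EuclideanSpace ℝ (Fin d) → ℝ)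
    (X : Set (EuclideanSpace ℝ (Fin n))) (Y : Set (EuclideanSpace ℝ (Fin d))) (r₁ r₂ : ℝ)
    (z : EuclideanSpace ℝ (Fin n)) (w : EuclideanSpace ℝ (Fin d)) : Prop :=
  ∀ v, saddleVal f X Y r₁ r₂ z v ≤ saddleVal f X Y r₁ r₂ z w

/-- The iterates of doubly smoothed gradient descent ascent, from arbitrary initial points. -/
structure IsDSGDA {n d : ℕ} (f : EuclideanSpace ℝ (Fin n) → EuclideanSpace ℝ (Fin d) → ℝ)
    (X : Set (EuclideanSpace ℝ (Fin n))) (Y : Set (EuclideanSpace ℝ (Fin d)))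
    (r₁ r₂ c α β μ : ℝ)
    (x : ℕ → EuclideanSpace ℝ (Fin n)) (y : ℕ → EuclideanSpace ℝ (Fin d))
    (z : ℕ → EuclideanSpace ℝ (Fin n)) (v : ℕ → EuclideanSpace ℝ (Fin d)) : Prop where
  step_x : ∀ t, x (t + 1) =
    projOn X (x t - c • gradient (fun a => regF f r₁ r₂ a (y t) (z t) (v t)) (x t))
  step_y : ∀ t, y (t + 1) =
    projOn Y (y t + α • gradient (fun b => regF f r₁ r₂ (x (t + 1)) b (z t) (v t)) (y t))
  step_z : ∀ t, z (t + 1) = z t + β • (x (t + 1) - z t)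
  step_v : ∀ t, v (t + 1) = v t + μ • (y (t + 1) - v t)

/-- The admissible regularization parameters, step sizes and extrapolation parameters, for the
Lipschitz constants `Lx = L` and `Ly = lam * L`. -/
structure ParamConditions (lam L r₁ r₂ c α β μ : ℝ) : Prop where
  r₁_ge : 2 * L ≤ r₁
  r₂_ge : 2 * (lam * L) ≤ r₂
  c_pos : 0 < c
  c_le : c ≤ min (4 / (3 * (L + r₁))) (1 / (6 * (lam * L)))
  α_pos : 0 < α
  α_le : α ≤ min (2 / (3 * (lam * L) * ((2 * c * r₁ + 1) / (c * (r₁ - L))) ^ 2))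
    (min (1 / (6 * ((lam * L / (r₁ - L) + 2) * (lam * L) + r₂)))
      (1 / (5 * lam * Real.sqrt (lam + 5) * L)))
  β_pos : 0 < β
  β_le : β ≤ min
    (24 * r₁ / (360 * r₁ + 5 * r₁ ^ 2 * lam + (2 * (lam * L) + 5 * r₁) ^ 2))
    (α * lam ^ 2 * L ^ 2 / (384 * r₁ * (lam + 5) * (lam + 1) ^ 2))
  μ_pos : 0 < μ
  μ_le : μ ≤ min (2 * (lam + 5) / (2 * (lam + 5) + lam ^ 2 * L ^ 2))
    (α * lam ^ 2 * L ^ 2 / (64 * r₂ * (lam + 5)))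

/-- The normal cone of a convex set `Y` at `y ∈ Y`, i.e. the subdifferential of its indicator. -/
def convexNormalCone {m : ℕ} (Y : Set (EuclideanSpace ℝ (Fin m)))
    (y : EuclideanSpace ℝ (Fin m)) : Set (EuclideanSpace ℝ (Fin m)) :=
  {u | ∀ w ∈ Y, inner ℝ u (w - y) ≤ 0}

/-- The Kurdyka–Łojasiewicz property with exponent `θ` and constant `τ` of the dual function:
`(max_{y' ∈ Y} f(x,y') - f(x,y))^θ ≤ (1/τ) dist(0, -∇_y f(x,y) + ∂1_Y(y))`. -/
structure DualKL {n d : ℕ} (f : EuclideanSpace ℝ (Fin n) → EuclideanSpace ℝ (Fin d) → ℝ)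
    (X : Set (EuclideanSpace ℝ (Fin n))) (Y : Set (EuclideanSpace ℝ (Fin d)))
    (τ θ : ℝ) : Prop where
  solvable : ∀ x ∈ X, ∃ y ∈ Y, IsMaxOn (fun b => f x b) Y y
  ineq : ∀ x ∈ X, ∀ y ∈ Y,
    (sSup ((fun b => f x b) '' Y) - f x y) ^ θ ≤
      1 / τ * Metric.infDist 0
        ((fun u => -gradient (fun b => f x b) y + u) '' convexNormalCone Y y)

/-- Concavity of the dual function. -/
def DualConcave {n d : ℕ} (f : EuclideanSpace ℝ (Fin n) → EuclideanSpace ℝ (Fin d) → ℝ)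
    (X : Set (EuclideanSpace ℝ (Fin n))) (Y : Set (EuclideanSpace ℝ (Fin d))) : Prop :=
  ∀ x ∈ X, ConcaveOn ℝ Y (fun y => f x y)

/-- The constant in the Kurdyka–Łojasiewicz case. -/
def omega0 (lam L r₁ r₂ μ τ θ : ℝ) : ℝ :=
  2 / ((r₁ - L) * τ ^ (1 / θ)) *
    (r₂ * (1 - μ) / μ + r₂ ^ 2 / (r₂ - lam * L)) ^ (1 / θ)

/-- The constant in the concave case. -/
def omega1 {d : ℕ} (Y : Set (EuclideanSpace ℝ (Fin d))) (lam L r₁ r₂ μ : ℝ) : ℝ :=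
  4 * r₂ * Metric.diam Y / (r₁ - L) * ((1 - μ) / μ + r₂ / (r₂ - lam * L))

end

/-! ### Strong and weak convexity, proximal optimality. -/

section StrongConvexity

/-! Since r₁ > L and r₂ > λL, a Lipschitz gradient makes F strongly convex in x with modulus m₁ = r₁
- L and strongly concave in y with modulus m₂ = r₂ - λL. Each (z,v) therefore has a saddle point
(x(z,v), y(x(z,v),z,v)). A maximizer w of p(z,·) is its own saddle component, y(x(z,w),z,w) = w
(`eq_of_isVSol`), so the penalty vanishes there.

Compare the saddle (x₁,y₁) at an arbitrary v with the saddle (x₂,w) at w. Quadratic growth of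
F(·,w,z,w) at x₂ and minimality of x₁ for F(·,y₁,z,v) give, after the z-penalties cancel, (m₁/2)‖x₁
- x₂‖² ≤ [f(x₁,w) - f(x₁,y₁)] + [f(x₂,y₁) - f(x₂,w)]. Here y₁ is a proximal maximizer of f(x₁,·)
with center v, and w one of f(x₂,·) with center w. An error bound B, controlling the gap in f by the
distance from a proximal maximizer to its center, makes the first bracket at most B(‖y₁ - v‖) and
the second at most B(0) ≤ 0 (`norm_xSol_sub_sq_le`). The KL inequality gives B(s) = (r₂s/τ)^(1/θ);
concavity gives B(s) = r₂·s·diam Y.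

Taking v₊ for v, it remains to bound ‖y₁ - v₊‖ by a multiple of ‖v₊ - v‖ (`norm_sub_vPlus_le`),
using that the y-component of the saddle is (r₂/m₂)-Lipschitz in v. -/

theorem eq_of_mul_norm_sub_sq_nonpos {E : Type*} [NormedAddCommGroup E] {m : ℝ} (hm : 0 < m) {a b : E}
    (h : m / 2 * ‖a - b‖ ^ 2 ≤ 0) : a = b := by
  have hsq : ‖a - b‖ ^ 2 ≤ 0 := nonpos_of_mul_nonpos_right h (half_pos hm)
  exact sub_eq_zero.1 (norm_eq_zero.1 (pow_eq_zero_iff two_ne_zero |>.1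
    (hsq.antisymm (sq_nonneg _))))

variable {E : Type*} [NormedAddCommGroup E] [InnerProductSpace ℝ E]

/-- Letting t tend to 0 from the right. It yields first-order conditions without derivatives:
compare values along a segment, divide by t, pass to the limit. -/
theorem le_of_forall_le_add_mul {a b c : ℝ}
    (h : ∀ t : ℝ, 0 < t → t < 1 → a ≤ b + t * c) : a ≤ b := by
  have hlim : Filter.Tendsto (fun t : ℝ => b + t * c) (nhdsWithin 0 (Set.Ioi 0)) (nhds b) := by
    have : Continuous fun t : ℝ => b + t * c := by fun_prop
    simpa using (this.tendsto 0).mono_left nhdsWithin_le_nhds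
  refine ge_of_tendsto hlim ?_
  filter_upwards [Ioo_mem_nhdsGT (zero_lt_one (α := ℝ))] with t ht using h t ht.1 ht.2

/-- Quadratic growth of a strongly convex function around its minimizer. -/
theorem StrongConvexOn.quadratic_growth {S : Set E} {m : ℝ} {g : E → ℝ} {a b : E}
    (hg : StrongConvexOn S m g) (ha : a ∈ S) (hb : b ∈ S) (hmin : IsMinOn g S a) :
    g a + m / 2 * ‖a - b‖ ^ 2 ≤ g b := by
  refine le_of_forall_le_add_mul (c := m / 2 * ‖a - b‖ ^ 2) fun t ht0 ht1 => ?_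
  have hconv := hg.2 ha hb (sub_pos.2 ht1).le ht0.le (by ring)
  have hle := hmin (hg.1 ha hb (sub_pos.2 ht1).le ht0.le (by ring))
  simp only [Set.mem_ofPred_eq, smul_eq_mul] at hconv hle
  have h := hle.trans hconv
  have : t * (g a + m / 2 * ‖a - b‖ ^ 2) ≤ t * (g b + t * (m / 2 * ‖a - b‖ ^ 2)) := by
    linarith
  exact le_of_mul_le_mul_left this ht0

theorem StrongConcaveOn.quadratic_decay {S : Set E} {m : ℝ} {g : E → ℝ} {a b : E}
    (hg : StrongConcaveOn S m g) (ha : a ∈ S) (hb : b ∈ S) (hmax : IsMaxOn g S a) :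
    g b + m / 2 * ‖a - b‖ ^ 2 ≤ g a := by
  have h := StrongConvexOn.quadratic_growth hg.neg ha hb hmax.neg
  simp only [Pi.neg_apply] at h
  linarith

theorem norm_convexCombination_sub_sq (a b z : E) {s t : ℝ} (hst : s + t = 1) :
    ‖s • a + t • b - z‖ ^ 2
      = s * ‖a - z‖ ^ 2 + t * ‖b - z‖ ^ 2 - s * t * ‖a - b‖ ^ 2 := by
  obtain rfl : s = 1 - t := by linarith
  have h1 : (1 - t) • a + t • b - z = (1 - t) • (a - z) + t • (b - z) := by module
  have h2 : a - b = (a - z) - (b - z) := by abel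
  rw [h1, h2, norm_add_sq_real, norm_sub_sq_real (a - z), norm_smul, norm_smul,
    inner_smul_left, inner_smul_right, mul_pow, mul_pow, Real.norm_eq_abs, Real.norm_eq_abs,
    sq_abs, sq_abs]
  simp only [conj_trivial]
  ring

/-- The quadratic term satisfies its convexity inequality with equality, so moduli add whatever
their signs. The use below has m = -K, where `StrongConvexOn` expresses weak convexity. -/
theorem StrongConvexOn.add_quadratic {S : Set E} {m : ℝ} {φ : E → ℝ} (hφ : StrongConvexOn S m φ)
    (r : ℝ) (z : E) : StrongConvexOn S (r + m) (fun u => φ u + r / 2 * ‖u - z‖ ^ 2) := by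
  refine ⟨hφ.1, fun a ha b hb s t hs ht hst => ?_⟩
  have h := hφ.2 ha hb hs ht hst
  simp only [smul_eq_mul] at h ⊢
  rw [norm_convexCombination_sub_sq a b z hst]
  linarith

/-- The vector r(a - v) acts as a supergradient of φ relative to S at the proximal point a; no
differentiability is needed, only concavity on the segment from a to b and t → 0. -/
theorem ConcaveOn.sub_le_inner_of_isMaxOn_prox {S : Set E} {φ : E → ℝ} (hφ : ConcaveOn ℝ S φ)
    {r : ℝ} {v a b : E} (ha : a ∈ S) (hb : b ∈ S)
    (hmax : IsMaxOn (fun u => φ u - r / 2 * ‖u - v‖ ^ 2) S a) :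
    φ b - φ a ≤ r * inner ℝ (a - v) (b - a) := by
  refine le_of_forall_le_add_mul (c := r / 2 * ‖b - a‖ ^ 2) fun t ht0 ht1 => ?_
  have hconc := hφ.2 ha hb (sub_pos.2 ht1).le ht0.le (by ring)
  have hle := hmax (hφ.1 ha hb (sub_pos.2 ht1).le ht0.le (by ring))
  have hpt : (1 - t) • a + t • b - v = (a - v) + t • (b - a) := by module
  simp only [Set.mem_ofPred_eq, smul_eq_mul] at hconc hle
  rw [hpt, norm_add_sq_real, norm_smul, inner_smul_right, mul_pow, Real.norm_eq_abs, sq_abs] at hle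
  refine le_of_mul_le_mul_left ?_ ht0
  linarith

variable [CompleteSpace E]

theorem HasGradientAt.hasDerivAt_comp_segment {φ : E → ℝ} {g a b : E} {t : ℝ}
    (h : HasGradientAt φ g (a + t • (b - a))) :
    HasDerivAt (fun s : ℝ => φ (a + s • (b - a))) (inner ℝ g (b - a)) t := by
  have hline : HasDerivAt (fun s : ℝ => a + s • (b - a)) (b - a) t := by
    simpa using ((hasDerivAt_id t).smul_const (b - a)).const_add a
  simpa [Function.comp_def] using h.hasFDerivAt.comp_hasDerivAt t hline

/-- A function with `K`-Lipschitz gradient is `K`-weakly convex. -/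
theorem strongConvexOn_neg_of_lipschitz_gradient {S : Set E} (hS : Convex ℝ S) {φ : E → ℝ}
    {g : E → E} {K : ℝ} (hφ : ∀ u, HasGradientAt φ (g u) u)
    (hK : ∀ a ∈ S, ∀ b ∈ S, ‖g a - g b‖ ≤ K * ‖a - b‖) : StrongConvexOn S (-K) φ := by
  refine ⟨hS, fun a ha b hb s t hs ht hst => ?_⟩
  -- On the segment the derivative of φ can decrease at rate at most K‖b - a‖²; the added quadratic
  -- compensates exactly, so ψ' is monotone.
  let ψ : ℝ → ℝ := fun τ => φ (a + τ • (b - a)) + K / 2 * ‖b - a‖ ^ 2 * τ ^ 2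
  have hderiv : ∀ τ, HasDerivAt ψ
      (inner ℝ (g (a + τ • (b - a))) (b - a) + K * ‖b - a‖ ^ 2 * τ) τ := by
    intro τ
    have h2 := (hasDerivAt_pow 2 τ).const_mul (K / 2 * ‖b - a‖ ^ 2)
    convert! (hφ (a + τ • (b - a))).hasDerivAt_comp_segment.add h2 using 1
    norm_num
    ring
  have hmem : ∀ τ ∈ Set.Icc (0 : ℝ) 1, a + τ • (b - a) ∈ S := fun τ hτ =>
    hS.add_smul_sub_mem ha hb hτ
  have hconv : ConvexOn ℝ (Set.Icc (0 : ℝ) 1) ψ := by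
    refine MonotoneOn.convexOn_of_deriv (convex_Icc 0 1)
      (fun τ _ => (hderiv τ).continuousAt.continuousWithinAt)
      (fun τ _ => (hderiv τ).differentiableAt.differentiableWithinAt) ?_
    intro p hp q hq hpq
    rw [(hderiv p).deriv, (hderiv q).deriv]
    have hpS := hmem p (interior_subset hp)
    have hqS := hmem q (interior_subset hq)
    have hbound := (hK _ hpS _ hqS).trans_eq (by
      rw [show a + p • (b - a) - (a + q • (b - a)) = (p - q) • (b - a) by module, norm_smul,
        Real.norm_eq_abs, abs_sub_comm, abs_of_nonneg (sub_nonneg.2 hpq)])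
    have hinner := (real_inner_le_norm (g (a + p • (b - a)) - g (a + q • (b - a))) (b - a)).trans
      (mul_le_mul_of_nonneg_right hbound (norm_nonneg _))
    rw [inner_sub_left] at hinner
    nlinarith
  have h := hconv.2 (Set.left_mem_Icc.2 zero_le_one) (Set.right_mem_Icc.2 zero_le_one) hs ht hst
  have hpt : a + t • (b - a) = s • a + t • b := by
    rw [show s = 1 - t by linarith]; module
  simp only [ψ, smul_eq_mul, mul_zero, mul_one, zero_add, zero_smul, add_zero, one_smul,
    add_sub_cancel, hpt] at h ⊢
  rw [norm_sub_rev a b]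
  rw [show s = 1 - t by linarith] at h ⊢
  nlinarith

/-- First-order optimality of a maximizer over a convex set. -/
theorem IsMaxOn.inner_gradient_le_zero {S : Set E} (hS : Convex ℝ S) {φ : E → ℝ} {g a b : E}
    (hmax : IsMaxOn φ S a) (ha : a ∈ S) (hb : b ∈ S) (hφ : HasGradientAt φ g a) :
    inner ℝ g (b - a) ≤ 0 := by
  have h := hmax.localize.hasFDerivWithinAt_nonpos hφ.hasFDerivAt.hasFDerivWithinAt
    (sub_mem_posTangentConeAt_of_segment_subset (hS.segment_subset ha hb))
  simpa using h

end StrongConvexity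

/-! ### From primal minimizers to saddle points. -/

section Saddle

variable {E E' : Type*} [NormedAddCommGroup E] [InnerProductSpace ℝ E]
  [NormedAddCommGroup E'] [InnerProductSpace ℝ E']

/-- A minimizer of the primal function of a convex-strongly concave function, together with the
corresponding maximizer, is a saddle point. -/
theorem isMinOn_of_isMinOn_primal {X : Set E} {Y : Set E'} {G : E → E' → ℝ} {m : ℝ} (hm : 0 < m)
    (hconv : ∀ y ∈ Y, ConvexOn ℝ X fun x => G x y) (hconc : ∀ x ∈ X, StrongConcaveOn Y m (G x))
    (hcont : ∀ x, Continuous (G x)) {x₀ : E} {y₀ : E'} (hx₀ : x₀ ∈ X) (hy₀ : y₀ ∈ Y)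
    (hmax : IsMaxOn (G x₀) Y y₀)
    (hmin : ∀ x ∈ X, ∃ y ∈ Y, IsMaxOn (G x) Y y ∧ G x₀ y₀ ≤ G x y) :
    IsMinOn (fun x => G x y₀) X x₀ := by
  intro x hx
  obtain ⟨y₁, -, hy₁, -⟩ := hmin x hx
  have key : ∀ k : ℕ, ∃ y, G x₀ y₀ ≤ G x y ∧
      ‖y₀ - y‖ ^ 2 ≤ 2 / m * (G x y₁ - G x₀ y₀) * (1 / ((k : ℝ) + 1)) := by
    intro k
    have hk : (0 : ℝ) < k + 1 := by positivity
    -- Move from x₀ toward x by a small t and take the maximizer y at the new point. This t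
    -- satisfies t/(1 - t) = 1/(k + 1) and stays away from 1 already at k = 0.
    set t : ℝ := 1 / ((k : ℝ) + 2) with ht
    have ht0 : 0 < t := by positivity
    have htk : t * (k + 1) = 1 - t := by rw [ht]; field_simp; ring
    have ht1 : 0 < 1 - t := htk ▸ by positivity
    have hxt := (hconv y₀ hy₀).1 hx₀ hx ht1.le ht0.le (by ring)
    obtain ⟨y, hy, -, hle⟩ := hmin _ hxt
    have h1 := (hconv y hy).2 hx₀ hx ht1.le ht0.le (by ring)
    have h2 := StrongConcaveOn.quadratic_decay (hconc x₀ hx₀) hy₀ hy hmax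
    have h3 : G x y ≤ G x y₁ := hy₁ hy
    simp only [smul_eq_mul] at h1
    have hsq : 0 ≤ m / 2 * ‖y₀ - y‖ ^ 2 := by positivity
    -- Minimality of x₀, convexity in x and quadratic decay of G x₀ at y₀ combine. This gives both G
    -- x₀ y₀ ≤ G x y and ‖y₀ - y‖² = O(1/(k + 1)), so y → y₀ and continuity transfers the inequality
    -- to y₀.
    have h4 : t * G x₀ y₀ + (1 - t) * (m / 2 * ‖y₀ - y‖ ^ 2) ≤ t * G x y := by
      nlinarith [mul_le_mul_of_nonneg_left h2 ht1.le]
    refine ⟨y, le_of_mul_le_mul_left (by nlinarith [mul_nonneg ht1.le hsq]) ht0, ?_⟩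
    rw [← htk] at h4
    have h5 : (k + 1 : ℝ) * (m / 2 * ‖y₀ - y‖ ^ 2) ≤ G x y₁ - G x₀ y₀ := by
      refine le_of_mul_le_mul_left ?_ ht0
      nlinarith
    have h6 : ‖y₀ - y‖ ^ 2
        = 2 / m * ((k + 1 : ℝ) * (m / 2 * ‖y₀ - y‖ ^ 2)) * (1 / ((k : ℝ) + 1)) := by
      field_simp
    rw [h6]
    gcongr
  choose y hle hdist using key
  have hlim : Filter.Tendsto (fun k : ℕ => 2 / m * (G x y₁ - G x₀ y₀) * (1 / ((k : ℝ) + 1)))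
      Filter.atTop (nhds 0) := by
    simpa using tendsto_one_div_add_atTop_nhds_zero_nat.const_mul (2 / m * (G x y₁ - G x₀ y₀))
  have hsq : Filter.Tendsto (fun k => ‖y₀ - y k‖ ^ 2) Filter.atTop (nhds 0) :=
    squeeze_zero (fun _ => by positivity) hdist hlim
  have hnorm : Filter.Tendsto (fun k => ‖y k - y₀‖) Filter.atTop (nhds 0) := by
    have := hsq.sqrt
    simpa [Real.sqrt_sq, norm_sub_rev y₀] using this
  have hy : Filter.Tendsto y Filter.atTop (nhds y₀) := tendsto_iff_norm_sub_tendsto_zero.2 hnorm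
  exact ge_of_tendsto (((hcont x).tendsto y₀).comp hy) (Filter.Eventually.of_forall hle)

end Saddle

/-! ### Properties and saddle points of the regularized function. -/

/-- The standing properties of the regularized problem: compact feasible sets, and a continuous
objective that is strongly convex in `x` and strongly concave in `y`. -/
structure StronglyConvexConcave {n d : ℕ}
    (f : EuclideanSpace ℝ (Fin n) → EuclideanSpace ℝ (Fin d) → ℝ)
    (X : Set (EuclideanSpace ℝ (Fin n))) (Y : Set (EuclideanSpace ℝ (Fin d)))
    (r₁ r₂ m₁ m₂ : ℝ) : Prop where
  nonempty_left : X.Nonempty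
  nonempty_right : Y.Nonempty
  compact_left : IsCompact X
  compact_right : IsCompact Y
  continuous : Continuous
    fun p : EuclideanSpace ℝ (Fin n) × EuclideanSpace ℝ (Fin d) => f p.1 p.2
  pos_left : 0 < m₁
  pos_right : 0 < m₂
  strongConvexOn : ∀ y ∈ Y, ∀ z v, StrongConvexOn X m₁ fun x => regF f r₁ r₂ x y z v
  strongConcaveOn : ∀ x ∈ X, ∀ z v, StrongConcaveOn Y m₂ fun y => regF f r₁ r₂ x y z v

/-- Saddle points of `F(·,·,z,v)` over `X × Y`. -/
structure IsRegSaddle {n d : ℕ}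
    (f : EuclideanSpace ℝ (Fin n) → EuclideanSpace ℝ (Fin d) → ℝ)
    (X : Set (EuclideanSpace ℝ (Fin n))) (Y : Set (EuclideanSpace ℝ (Fin d))) (r₁ r₂ : ℝ)
    (z : EuclideanSpace ℝ (Fin n)) (v : EuclideanSpace ℝ (Fin d))
    (x : EuclideanSpace ℝ (Fin n)) (y : EuclideanSpace ℝ (Fin d)) : Prop where
  left_mem : x ∈ X
  right_mem : y ∈ Y
  isMinOn : IsMinOn (fun a => regF f r₁ r₂ a y z v) X x
  isMaxOn : IsMaxOn (fun b => regF f r₁ r₂ x b z v) Y y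

/-! ### Consequences of Lipschitz gradients; error bounds for proximal maximizers. -/

section LipschitzGradient

variable {n d : ℕ} {f : EuclideanSpace ℝ (Fin n) → EuclideanSpace ℝ (Fin d) → ℝ}
  {X : Set (EuclideanSpace ℝ (Fin n))} {Y : Set (EuclideanSpace ℝ (Fin d))} {Lx Ly : ℝ}

theorem LipschitzGradient.hasGradientAt_left (hf : LipschitzGradient f X Y Lx Ly)
    (x : EuclideanSpace ℝ (Fin n)) (y : EuclideanSpace ℝ (Fin d)) :
    HasGradientAt (fun a => f a y) (gradient (fun a => f a y) x) x := by
  have h : ContDiff ℝ 1 fun a => f a y := hf.contDiff.comp (contDiff_id.prodMk contDiff_const)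
  exact (h.differentiable one_ne_zero x).hasGradientAt

theorem LipschitzGradient.hasGradientAt_right (hf : LipschitzGradient f X Y Lx Ly)
    (x : EuclideanSpace ℝ (Fin n)) (y : EuclideanSpace ℝ (Fin d)) :
    HasGradientAt (fun b => f x b) (gradient (fun b => f x b) y) y := by
  have h : ContDiff ℝ 1 fun b => f x b := hf.contDiff.comp (contDiff_const.prodMk contDiff_id)
  exact (h.differentiable one_ne_zero y).hasGradientAt

theorem LipschitzGradient.strongConvexOn_regF (hf : LipschitzGradient f X Y Lx Ly)
    (hX : Convex ℝ X) (r₁ r₂ : ℝ) {y : EuclideanSpace ℝ (Fin d)} (hy : y ∈ Y)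
    (z : EuclideanSpace ℝ (Fin n)) (v : EuclideanSpace ℝ (Fin d)) :
    StrongConvexOn X (r₁ - Lx) fun x => regF f r₁ r₂ x y z v := by
  have h := StrongConvexOn.add_quadratic (strongConvexOn_neg_of_lipschitz_gradient hX
    (fun u => hf.hasGradientAt_left u y)
    (fun a ha b hb => by simpa using hf.lipschitz_x a ha b hb y hy y hy)) r₁ z
  refine ⟨hX, fun a ha b hb s t hs ht hst => ?_⟩
  have h2 := h.2 ha hb hs ht hst
  simp only [regF, smul_eq_mul] at h2 ⊢
  obtain rfl : s = 1 - t := by linarith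
  linarith

theorem LipschitzGradient.strongConcaveOn_regF (hf : LipschitzGradient f X Y Lx Ly)
    (hY : Convex ℝ Y) (r₁ r₂ : ℝ) {x : EuclideanSpace ℝ (Fin n)} (hx : x ∈ X)
    (z : EuclideanSpace ℝ (Fin n)) (v : EuclideanSpace ℝ (Fin d)) :
    StrongConcaveOn Y (r₂ - Ly) fun y => regF f r₁ r₂ x y z v := by
  have hgrad : ∀ u, HasGradientAt (fun b => -f x b) (-gradient (fun b => f x b) u) u := by
    intro u
    rw [hasGradientAt_iff_hasFDerivAt, map_neg]
    exact (hf.hasGradientAt_right x u).hasFDerivAt.neg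
  have h := StrongConvexOn.add_quadratic (strongConvexOn_neg_of_lipschitz_gradient hY hgrad
    (fun a ha b hb => by
      rw [neg_sub_neg, norm_sub_rev]
      simpa using hf.lipschitz_y x hx x hx a ha b hb)) r₂ v
  refine ⟨hY, fun a ha b hb s t hs ht hst => ?_⟩
  have h2 := h.2 ha hb hs ht hst
  simp only [regF, smul_eq_mul] at h2 ⊢
  obtain rfl : s = 1 - t := by linarith
  linarith

theorem LipschitzGradient.stronglyConvexConcave (hf : LipschitzGradient f X Y Lx Ly)
    (hXne : X.Nonempty) (hXconv : Convex ℝ X) (hXcomp : IsCompact X)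
    (hYne : Y.Nonempty) (hYconv : Convex ℝ Y) (hYcomp : IsCompact Y)
    {r₁ r₂ : ℝ} (h₁ : Lx < r₁) (h₂ : Ly < r₂) :
    StronglyConvexConcave f X Y r₁ r₂ (r₁ - Lx) (r₂ - Ly) where
  nonempty_left := hXne
  nonempty_right := hYne
  compact_left := hXcomp
  compact_right := hYcomp
  continuous := hf.contDiff.continuous
  pos_left := sub_pos.2 h₁
  pos_right := sub_pos.2 h₂
  strongConvexOn _ hy z v := hf.strongConvexOn_regF hXconv r₁ r₂ hy z v
  strongConcaveOn _ hx z v := hf.strongConcaveOn_regF hYconv r₁ r₂ hx z v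

/-- Error bound from the Kurdyka–Łojasiewicz property for proximal maximizers. -/
theorem DualKL.sub_le_rpow_of_isMaxOn_prox {τ θ r : ℝ} (hKL : DualKL f X Y τ θ) (hτ : 0 < τ)
    (hθ : 0 < θ) (hr : 0 ≤ r) (hf : LipschitzGradient f X Y Lx Ly) (hY : Convex ℝ Y)
    (hYcomp : IsCompact Y)
    {x : EuclideanSpace ℝ (Fin n)} (hx : x ∈ X) {y y' v : EuclideanSpace ℝ (Fin d)} (hy : y ∈ Y)
    (hy' : y' ∈ Y) (hmax : IsMaxOn (fun b => f x b - r / 2 * ‖b - v‖ ^ 2) Y y) :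
    f x y' - f x y ≤ (r * ‖y - v‖ / τ) ^ (1 / θ) := by
  have hcont : Continuous fun b => f x b :=
    hf.contDiff.continuous.comp (continuous_const.prodMk continuous_id)
  have hbdd : BddAbove ((fun b => f x b) '' Y) := (hYcomp.image hcont).bddAbove
  have hle : ∀ w ∈ Y, f x w ≤ sSup ((fun b => f x b) '' Y) := fun w hw =>
    le_csSup hbdd ⟨w, hw, rfl⟩
  have hgrad : HasGradientAt (fun b => f x b - r / 2 * ‖b - v‖ ^ 2)
      (gradient (fun b => f x b) y - r • (y - v)) y := by
    rw [hasGradientAt_iff_hasFDerivAt]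
    have h1 := ((hasFDerivAt_id y).sub_const v).norm_sq.const_mul (r / 2)
    have h2 := (hf.hasGradientAt_right x y).hasFDerivAt.sub h1
    convert! h2 using 1
    ext w
    simp
    ring
  -- First-order optimality of y puts this vector in the normal cone, so -r(y - v) lies in -∇_y f +
  -- N_Y(y) and the distance of that set from 0 is at most r‖y - v‖.
  have hcone : gradient (fun b => f x b) y - r • (y - v) ∈ convexNormalCone Y y := fun w hw =>
    hmax.inner_gradient_le_zero hY hy hw hgrad
  have hdist : Metric.infDist 0
      ((fun u => -gradient (fun b => f x b) y + u) '' convexNormalCone Y y) ≤ r * ‖y - v‖ := by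
    refine (Metric.infDist_le_dist_of_mem (Set.mem_image_of_mem _ hcone)).trans_eq ?_
    rw [dist_zero_left, show -gradient (fun b => f x b) y
      + (gradient (fun b => f x b) y - r • (y - v)) = -(r • (y - v)) by abel, norm_neg, norm_smul,
      Real.norm_of_nonneg hr]
  have hineq := (hKL.ineq x hx y hy).trans (mul_le_mul_of_nonneg_left hdist (by positivity))
  have hnonneg : 0 ≤ sSup ((fun b => f x b) '' Y) - f x y := sub_nonneg.2 (hle y hy)
  calc f x y' - f x y ≤ sSup ((fun b => f x b) '' Y) - f x y := by linarith [hle y' hy']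
    _ = ((sSup ((fun b => f x b) '' Y) - f x y) ^ θ) ^ (1 / θ) := by
      rw [one_div, Real.rpow_rpow_inv hnonneg hθ.ne']
    _ ≤ (1 / τ * (r * ‖y - v‖)) ^ (1 / θ) :=
      Real.rpow_le_rpow (Real.rpow_nonneg hnonneg _) hineq (by positivity)
    _ = (r * ‖y - v‖ / τ) ^ (1 / θ) := by rw [one_div_mul_eq_div]

/-- Error bound from concavity for proximal maximizers. -/
theorem DualConcave.sub_le_of_isMaxOn_prox {r : ℝ} (hconc : DualConcave f X Y) (hr : 0 ≤ r)
    (hYcomp : IsCompact Y)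
    {x : EuclideanSpace ℝ (Fin n)} (hx : x ∈ X) {y y' v : EuclideanSpace ℝ (Fin d)} (hy : y ∈ Y)
    (hy' : y' ∈ Y) (hmax : IsMaxOn (fun b => f x b - r / 2 * ‖b - v‖ ^ 2) Y y) :
    f x y' - f x y ≤ r * ‖y - v‖ * Metric.diam Y := by
  refine ((hconc x hx).sub_le_inner_of_isMaxOn_prox hy hy' hmax).trans ?_
  rw [mul_assoc]
  have hdiam : ‖y' - y‖ ≤ Metric.diam Y :=
    dist_eq_norm y' y ▸ Metric.dist_le_diam_of_mem hYcomp.isBounded hy' hy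
  gcongr
  exact (real_inner_le_norm _ _).trans (by gcongr)

end LipschitzGradient

/-! ### Existence, uniqueness and stability of the solution maps. -/

namespace StronglyConvexConcave

variable {n d : ℕ} {f : EuclideanSpace ℝ (Fin n) → EuclideanSpace ℝ (Fin d) → ℝ}
  {X : Set (EuclideanSpace ℝ (Fin n))} {Y : Set (EuclideanSpace ℝ (Fin d))} {r₁ r₂ m₁ m₂ : ℝ}

theorem continuous_regF (H : StronglyConvexConcave f X Y r₁ r₂ m₁ m₂)
    (z : EuclideanSpace ℝ (Fin n)) :
    Continuous fun p : EuclideanSpace ℝ (Fin n) × EuclideanSpace ℝ (Fin d) ×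
      EuclideanSpace ℝ (Fin d) => regF f r₁ r₂ p.1 p.2.1 z p.2.2 := by
  have h : Continuous fun p : EuclideanSpace ℝ (Fin n) × EuclideanSpace ℝ (Fin d) ×
      EuclideanSpace ℝ (Fin d) => f p.1 p.2.1 :=
    H.continuous.comp (continuous_fst.prodMk (continuous_fst.comp continuous_snd))
  exact (h.add (by fun_prop)).sub (by fun_prop)

theorem continuous_regF_left (H : StronglyConvexConcave f X Y r₁ r₂ m₁ m₂)
    (y : EuclideanSpace ℝ (Fin d)) (z : EuclideanSpace ℝ (Fin n)) (v : EuclideanSpace ℝ (Fin d)) :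
    Continuous fun x => regF f r₁ r₂ x y z v :=
  (H.continuous_regF z).comp (continuous_id.prodMk (continuous_const (y := (y, v))))

theorem continuous_regF_right (H : StronglyConvexConcave f X Y r₁ r₂ m₁ m₂)
    (x : EuclideanSpace ℝ (Fin n)) (z : EuclideanSpace ℝ (Fin n)) (v : EuclideanSpace ℝ (Fin d)) :
    Continuous fun y => regF f r₁ r₂ x y z v :=
  (H.continuous_regF z).comp (continuous_const.prodMk (continuous_id.prodMk continuous_const))

theorem exists_isMaxOn_regF (H : StronglyConvexConcave f X Y r₁ r₂ m₁ m₂)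
    (x : EuclideanSpace ℝ (Fin n)) (z : EuclideanSpace ℝ (Fin n)) (v : EuclideanSpace ℝ (Fin d)) :
    ∃ y ∈ Y, IsMaxOn (fun b => regF f r₁ r₂ x b z v) Y y :=
  H.compact_right.exists_isMaxOn H.nonempty_right (H.continuous_regF_right x z v).continuousOn

theorem existsUnique_isMaxOn_regF (H : StronglyConvexConcave f X Y r₁ r₂ m₁ m₂)
    {x : EuclideanSpace ℝ (Fin n)} (hx : x ∈ X) (z : EuclideanSpace ℝ (Fin n))
    (v : EuclideanSpace ℝ (Fin d)) :
    ∃! y, y ∈ Y ∧ IsMaxOn (fun b => regF f r₁ r₂ x b z v) Y y := by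
  obtain ⟨y, hy, hmax⟩ := H.exists_isMaxOn_regF x z v
  refine ⟨y, ⟨hy, hmax⟩, fun y' hy' => ?_⟩
  have h := (H.strongConcaveOn x hx z v).quadratic_decay hy hy'.1 hmax
  have h' : regF f r₁ r₂ x y z v ≤ regF f r₁ r₂ x y' z v := hy'.2 hy
  exact (eq_of_mul_norm_sub_sq_nonpos H.pos_right (by linarith)).symm

theorem regF_le_primalVal (H : StronglyConvexConcave f X Y r₁ r₂ m₁ m₂)
    (x : EuclideanSpace ℝ (Fin n)) {y : EuclideanSpace ℝ (Fin d)} (hy : y ∈ Y)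
    (z : EuclideanSpace ℝ (Fin n)) (v : EuclideanSpace ℝ (Fin d)) :
    regF f r₁ r₂ x y z v ≤ primalVal f Y r₁ r₂ x z v :=
  le_csSup (H.compact_right.image (H.continuous_regF_right x z v)).bddAbove ⟨y, hy, rfl⟩

theorem primalVal_eq (H : StronglyConvexConcave f X Y r₁ r₂ m₁ m₂)
    {x : EuclideanSpace ℝ (Fin n)} {y : EuclideanSpace ℝ (Fin d)} (hy : y ∈ Y)
    {z : EuclideanSpace ℝ (Fin n)} {v : EuclideanSpace ℝ (Fin d)}
    (hmax : IsMaxOn (fun b => regF f r₁ r₂ x b z v) Y y) :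
    primalVal f Y r₁ r₂ x z v = regF f r₁ r₂ x y z v :=
  (csSup_le (H.nonempty_right.image _) (Set.forall_mem_image.2 fun _ hb => hmax hb)).antisymm
    (H.regF_le_primalVal x hy z v)

theorem dualVal_le_regF (H : StronglyConvexConcave f X Y r₁ r₂ m₁ m₂)
    {x : EuclideanSpace ℝ (Fin n)} (hx : x ∈ X) (y : EuclideanSpace ℝ (Fin d))
    (z : EuclideanSpace ℝ (Fin n)) (v : EuclideanSpace ℝ (Fin d)) :
    dualVal f X r₁ r₂ y z v ≤ regF f r₁ r₂ x y z v :=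
  csInf_le (H.compact_left.image (H.continuous_regF_left y z v)).bddBelow ⟨x, hx, rfl⟩

theorem dualVal_eq (H : StronglyConvexConcave f X Y r₁ r₂ m₁ m₂)
    {x : EuclideanSpace ℝ (Fin n)} (hx : x ∈ X) {y : EuclideanSpace ℝ (Fin d)}
    {z : EuclideanSpace ℝ (Fin n)} {v : EuclideanSpace ℝ (Fin d)}
    (hmin : IsMinOn (fun a => regF f r₁ r₂ a y z v) X x) :
    dualVal f X r₁ r₂ y z v = regF f r₁ r₂ x y z v :=
  (H.dualVal_le_regF hx y z v).antisymm
    (le_csInf (H.nonempty_left.image _) (Set.forall_mem_image.2 fun _ ha => hmin ha))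

theorem exists_isMinOn_primalVal (H : StronglyConvexConcave f X Y r₁ r₂ m₁ m₂)
    (z : EuclideanSpace ℝ (Fin n)) (v : EuclideanSpace ℝ (Fin d)) :
    ∃ x ∈ X, IsMinOn (fun a => primalVal f Y r₁ r₂ a z v) X x := by
  have hcont : Continuous fun a => primalVal f Y r₁ r₂ a z v := by
    refine H.compact_right.continuous_sSup (f := fun a b => regF f r₁ r₂ a b z v) ?_
    exact (H.continuous_regF z).comp
      (continuous_fst.prodMk (continuous_snd.prodMk continuous_const))
  exact H.compact_left.exists_isMinOn H.nonempty_left hcont.continuousOn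

theorem isRegSaddle_of_isMinOn_primalVal (H : StronglyConvexConcave f X Y r₁ r₂ m₁ m₂)
    {x : EuclideanSpace ℝ (Fin n)} (hx : x ∈ X) {y : EuclideanSpace ℝ (Fin d)} (hy : y ∈ Y)
    {z : EuclideanSpace ℝ (Fin n)} {v : EuclideanSpace ℝ (Fin d)}
    (hmin : IsMinOn (fun a => primalVal f Y r₁ r₂ a z v) X x)
    (hmax : IsMaxOn (fun b => regF f r₁ r₂ x b z v) Y y) : IsRegSaddle f X Y r₁ r₂ z v x y where
  left_mem := hx
  right_mem := hy
  isMaxOn := hmax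
  isMinOn := by
    refine isMinOn_of_isMinOn_primal (G := fun a b => regF f r₁ r₂ a b z v) H.pos_right
      (fun b hb => (H.strongConvexOn b hb z v).convexOn ?_)
      (fun a ha => H.strongConcaveOn a ha z v) (fun a => H.continuous_regF_right a z v)
      hx hy hmax fun a ha => ?_
    · intro s
      have := H.pos_left
      simp only [Pi.zero_apply]
      positivity
    · obtain ⟨b, hb, hbmax⟩ := H.exists_isMaxOn_regF a z v
      refine ⟨b, hb, hbmax, ?_⟩
      rw [← H.primalVal_eq hy hmax, ← H.primalVal_eq hb hbmax]
      exact hmin ha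

/-- The four saddle inequalities close a cycle through (x,y), (x',y), (x',y'), (x,y'); the growth
term in the first edge must vanish. Through it, uniqueness of the primal minimizer follows without
proving the max-function strongly convex. -/
theorem isRegSaddle_left_unique (H : StronglyConvexConcave f X Y r₁ r₂ m₁ m₂)
    {z : EuclideanSpace ℝ (Fin n)} {v : EuclideanSpace ℝ (Fin d)}
    {x x' : EuclideanSpace ℝ (Fin n)} {y y' : EuclideanSpace ℝ (Fin d)}
    (h : IsRegSaddle f X Y r₁ r₂ z v x y) (h' : IsRegSaddle f X Y r₁ r₂ z v x' y') : x' = x := by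
  have h1 := (H.strongConvexOn y h.right_mem z v).quadratic_growth h.left_mem h'.left_mem h.isMinOn
  have h2 : regF f r₁ r₂ x' y z v ≤ regF f r₁ r₂ x' y' z v := h'.isMaxOn h.right_mem
  have h3 : regF f r₁ r₂ x' y' z v ≤ regF f r₁ r₂ x y' z v := h'.isMinOn h.left_mem
  have h4 : regF f r₁ r₂ x y' z v ≤ regF f r₁ r₂ x y z v := h.isMaxOn h'.right_mem
  exact (eq_of_mul_norm_sub_sq_nonpos H.pos_left (by linarith)).symm

theorem existsUnique_isMinOn_primalVal (H : StronglyConvexConcave f X Y r₁ r₂ m₁ m₂)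
    (z : EuclideanSpace ℝ (Fin n)) (v : EuclideanSpace ℝ (Fin d)) :
    ∃! x, x ∈ X ∧ IsMinOn (fun a => primalVal f Y r₁ r₂ a z v) X x := by
  obtain ⟨x, hx, hmin⟩ := H.exists_isMinOn_primalVal z v
  obtain ⟨y, hy, hmax⟩ := H.exists_isMaxOn_regF x z v
  refine ⟨x, ⟨hx, hmin⟩, fun x' hx' => ?_⟩
  obtain ⟨y', hy', hmax'⟩ := H.exists_isMaxOn_regF x' z v
  exact H.isRegSaddle_left_unique (H.isRegSaddle_of_isMinOn_primalVal hx hy hmin hmax)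
    (H.isRegSaddle_of_isMinOn_primalVal hx'.1 hy' hx'.2 hmax')

theorem isRegSaddle_xSol_ySol (H : StronglyConvexConcave f X Y r₁ r₂ m₁ m₂)
    (z : EuclideanSpace ℝ (Fin n)) (v : EuclideanSpace ℝ (Fin d)) :
    IsRegSaddle f X Y r₁ r₂ z v (xSol f X Y r₁ r₂ z v)
      (ySol f Y r₁ r₂ (xSol f X Y r₁ r₂ z v) z v) := by
  have hx : xSol f X Y r₁ r₂ z v ∈ X ∧
      IsMinOn (fun a => primalVal f Y r₁ r₂ a z v) X (xSol f X Y r₁ r₂ z v) :=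
    Classical.epsilon_spec (H.exists_isMinOn_primalVal z v)
  have hy : ySol f Y r₁ r₂ (xSol f X Y r₁ r₂ z v) z v ∈ Y ∧
      IsMaxOn (fun b => regF f r₁ r₂ (xSol f X Y r₁ r₂ z v) b z v) Y
        (ySol f Y r₁ r₂ (xSol f X Y r₁ r₂ z v) z v) :=
    Classical.epsilon_spec (H.exists_isMaxOn_regF _ z v)
  exact H.isRegSaddle_of_isMinOn_primalVal hx.1 hy.1 hx.2 hy.2

theorem bddAbove_dualVal (H : StronglyConvexConcave f X Y r₁ r₂ m₁ m₂)
    (z : EuclideanSpace ℝ (Fin n)) (v : EuclideanSpace ℝ (Fin d)) :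
    BddAbove ((fun y => dualVal f X r₁ r₂ y z v) '' Y) := by
  obtain ⟨x, hx⟩ := H.nonempty_left
  refine ⟨primalVal f Y r₁ r₂ x z v, Set.forall_mem_image.2 fun y hy => ?_⟩
  exact (H.dualVal_le_regF hx y z v).trans (H.regF_le_primalVal x hy z v)

/-- The penalty only lowers F, so d(b,z,v) ≤ d(b,z,b) for all v. Maximizing p(z,·) over the whole
space thus reduces to maximizing b ↦ d(b,z,b) over the compact set Y. -/
theorem exists_isVSol (H : StronglyConvexConcave f X Y r₁ r₂ m₁ m₂) (hr : 0 ≤ r₂)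
    (z : EuclideanSpace ℝ (Fin n)) : ∃ w, IsVSol f X Y r₁ r₂ z w := by
  have hcont : Continuous fun b => dualVal f X r₁ r₂ b z b := by
    refine H.compact_left.continuous_sInf (f := fun b a => regF f r₁ r₂ a b z b) ?_
    exact (H.continuous_regF z).comp
      (continuous_snd.prodMk (continuous_fst.prodMk continuous_fst))
  obtain ⟨w, hw, hmax⟩ := H.compact_right.exists_isMaxOn H.nonempty_right hcont.continuousOn
  refine ⟨w, fun v => ?_⟩
  calc saddleVal f X Y r₁ r₂ z v ≤ dualVal f X r₁ r₂ w z w := by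
        refine csSup_le (H.nonempty_right.image _) (Set.forall_mem_image.2 fun b hb => ?_)
        refine le_trans ?_ (hmax hb)
        refine le_csInf (H.nonempty_left.image _) (Set.forall_mem_image.2 fun a ha => ?_)
        refine (H.dualVal_le_regF ha b z v).trans ?_
        simp only [regF, sub_self, norm_zero]
        have : 0 ≤ r₂ / 2 * ‖b - v‖ ^ 2 := by positivity
        linarith
    _ ≤ saddleVal f X Y r₁ r₂ z w := le_csSup (H.bddAbove_dualVal z w) ⟨w, hw, rfl⟩

/-- A maximizer `w` of `p(z,·)` is the `y`-component of the saddle point of `F(·,·,z,w)`. -/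
theorem eq_of_isVSol (H : StronglyConvexConcave f X Y r₁ r₂ m₁ m₂) (hr : 0 < r₂)
    {z : EuclideanSpace ℝ (Fin n)} {w : EuclideanSpace ℝ (Fin d)}
    (hw : IsVSol f X Y r₁ r₂ z w) {x : EuclideanSpace ℝ (Fin n)} {y : EuclideanSpace ℝ (Fin d)}
    (h : IsRegSaddle f X Y r₁ r₂ z w x y) : y = w := by
  -- The v-penalty does not depend on the first variable, so recentering it from w to y keeps x a
  -- minimizer.
  have hmin : IsMinOn (fun a => regF f r₁ r₂ a y z y) X x := by
    intro a ha
    have := h.isMinOn ha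
    simp only [Set.mem_ofPred_eq, regF] at this ⊢
    linarith
  have h1 : regF f r₁ r₂ x y z y ≤ saddleVal f X Y r₁ r₂ z y :=
    (H.dualVal_eq h.left_mem hmin).symm.trans_le
      (le_csSup (H.bddAbove_dualVal z y) ⟨y, h.right_mem, rfl⟩)
  have h2 : saddleVal f X Y r₁ r₂ z w ≤ regF f r₁ r₂ x y z w :=
    csSup_le (H.nonempty_right.image _) (Set.forall_mem_image.2 fun b hb =>
      (H.dualVal_le_regF h.left_mem b z w).trans (h.isMaxOn hb))
  -- Recentering at y gains (r₂/2)‖y - w‖², which the maximality of w forces to be zero.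
  have h3 := (h1.trans (hw y)).trans h2
  simp only [regF, sub_self, norm_zero] at h3
  exact eq_of_mul_norm_sub_sq_nonpos hr (by linarith)

/-- The `y`-component of the saddle point is Lipschitz in `v`. -/
theorem norm_sub_right_le (H : StronglyConvexConcave f X Y r₁ r₂ m₁ m₂) (hr : 0 < r₂)
    {z : EuclideanSpace ℝ (Fin n)} {v v' : EuclideanSpace ℝ (Fin d)}
    {x x' : EuclideanSpace ℝ (Fin n)} {y y' : EuclideanSpace ℝ (Fin d)}
    (h : IsRegSaddle f X Y r₁ r₂ z v x y) (h' : IsRegSaddle f X Y r₁ r₂ z v' x' y') :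
    ‖y - y'‖ ≤ r₂ / m₂ * ‖v - v'‖ := by
  have h1 := (H.strongConcaveOn x h.left_mem z v).quadratic_decay h.right_mem h'.right_mem
    h.isMaxOn
  have h2 := (H.strongConcaveOn x' h'.left_mem z v').quadratic_decay h'.right_mem h.right_mem
    h'.isMaxOn
  have h3 : regF f r₁ r₂ x y z v ≤ regF f r₁ r₂ x' y z v := h.isMinOn h'.left_mem
  have h4 : regF f r₁ r₂ x' y' z v' ≤ regF f r₁ r₂ x y' z v' := h'.isMinOn h.left_mem
  have hpos := H.pos_right
  have hpolar : ‖y - v'‖ ^ 2 + ‖y' - v‖ ^ 2 - ‖y - v‖ ^ 2 - ‖y' - v'‖ ^ 2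
      = 2 * inner ℝ (y - y') (v - v') := by
    simp only [norm_sub_sq_real, inner_sub_left, inner_sub_right]
    ring
  have hinner := mul_le_mul_of_nonneg_left (real_inner_le_norm (y - y') (v - v')) hr.le
  rw [norm_sub_rev y' y] at h2
  simp only [regF] at h1 h2 h3 h4
  -- Adding `h1` to `h4`, all f-terms and z-penalties cancel around the cycle; the v-penalties leave
  -- r₂⟨y - y', v - v'⟩ by `hpolar`, bounded by Cauchy–Schwarz.
  have key : ‖y - y'‖ * (m₂ * ‖y - y'‖) ≤ ‖y - y'‖ * (r₂ * ‖v - v'‖) := by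
    nlinarith
  rw [div_mul_eq_mul_div, le_div_iff₀ hpos, mul_comm]
  rcases (norm_nonneg (y - y')).eq_or_lt with h0 | h0
  · rw [← h0]; simp only [mul_zero]; positivity
  · exact le_of_mul_le_mul_left key h0

/-- Triangle inequality through the saddle component `yv` at v: the definition of v₊ gives yv - v₊ =
((1 - μ)/μ)(v₊ - v), and Lipschitz dependence bounds ‖y - yv‖ by (r₂/m₂)‖v₊ - v‖. -/
theorem norm_sub_vPlus_le (H : StronglyConvexConcave f X Y r₁ r₂ m₁ m₂) (hr : 0 < r₂) {μ : ℝ}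
    (hμ0 : 0 < μ) (hμ1 : μ ≤ 1) (z : EuclideanSpace ℝ (Fin n)) (v : EuclideanSpace ℝ (Fin d))
    {x : EuclideanSpace ℝ (Fin n)} {y : EuclideanSpace ℝ (Fin d)}
    (h : IsRegSaddle f X Y r₁ r₂ z (vPlus f X Y r₁ r₂ μ z v) x y) :
    ‖y - vPlus f X Y r₁ r₂ μ z v‖
      ≤ ((1 - μ) / μ + r₂ / m₂) * ‖vPlus f X Y r₁ r₂ μ z v - v‖ := by
  have hsaddle := H.isRegSaddle_xSol_ySol z v
  set yv := ySol f Y r₁ r₂ (xSol f X Y r₁ r₂ z v) z v with hyv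
  have hlip := H.norm_sub_right_le hr h hsaddle
  have hplus : vPlus f X Y r₁ r₂ μ z v = v + μ • (yv - v) := rfl
  have hyp : yv - vPlus f X Y r₁ r₂ μ z v
      = ((1 - μ) / μ) • (vPlus f X Y r₁ r₂ μ z v - v) := by
    rw [hplus, add_sub_cancel_left, smul_smul, div_mul_cancel₀ _ hμ0.ne']
    module
  have hnorm : ‖yv - vPlus f X Y r₁ r₂ μ z v‖
      = (1 - μ) / μ * ‖vPlus f X Y r₁ r₂ μ z v - v‖ := by
    rw [hyp, norm_smul, Real.norm_of_nonneg (div_nonneg (sub_nonneg.2 hμ1) hμ0.le)]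
  have htri := norm_sub_le_norm_sub_add_norm_sub y yv (vPlus f X Y r₁ r₂ μ z v)
  linarith

/-- The distance between primal solutions is controlled by a dual error bound, provided the
error bound forces proximal fixed points to be maximizers. -/
theorem norm_xSol_sub_sq_le (H : StronglyConvexConcave f X Y r₁ r₂ m₁ m₂) (hr : 0 < r₂)
    {z : EuclideanSpace ℝ (Fin n)} {v w : EuclideanSpace ℝ (Fin d)}
    (hw : IsVSol f X Y r₁ r₂ z w) {B : ℝ → ℝ} (hB0 : B 0 ≤ 0)
    (hB : ∀ x ∈ X, ∀ y ∈ Y, ∀ y' ∈ Y, ∀ u,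
      IsMaxOn (fun b => f x b - r₂ / 2 * ‖b - u‖ ^ 2) Y y → f x y' - f x y ≤ B ‖y - u‖) :
    ‖xSol f X Y r₁ r₂ z v - xSol f X Y r₁ r₂ z w‖ ^ 2
      ≤ 2 / m₁ * B ‖ySol f Y r₁ r₂ (xSol f X Y r₁ r₂ z v) z v - v‖ := by
  have hv := H.isRegSaddle_xSol_ySol z v
  have hsw := H.isRegSaddle_xSol_ySol z w
  rw [H.eq_of_isVSol hr hw hsw] at hsw
  set x₁ := xSol f X Y r₁ r₂ z v
  set y₁ := ySol f Y r₁ r₂ x₁ z v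
  set x₂ := xSol f X Y r₁ r₂ z w
  have hprox : ∀ {x y u}, IsRegSaddle f X Y r₁ r₂ z u x y →
      IsMaxOn (fun b => f x b - r₂ / 2 * ‖b - u‖ ^ 2) Y y := by
    intro x y u h b hb
    have := h.isMaxOn hb
    simp only [Set.mem_ofPred_eq, regF] at this ⊢
    linarith
  have h1 := hB x₁ hv.left_mem y₁ hv.right_mem w hsw.right_mem v (hprox hv)
  -- Here the proximal center equals the proximal point w, so the bound is B 0 ≤ 0.
  have h2 := hB x₂ hsw.left_mem w hsw.right_mem y₁ hv.right_mem w (hprox hsw)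
  rw [sub_self, norm_zero] at h2
  have h3 := (H.strongConvexOn w hsw.right_mem z w).quadratic_growth hsw.left_mem hv.left_mem
    hsw.isMinOn
  have h4 : regF f r₁ r₂ x₁ y₁ z v ≤ regF f r₁ r₂ x₂ y₁ z v := hv.isMinOn hsw.left_mem
  simp only [regF] at h3 h4
  rw [norm_sub_rev x₂ x₁] at h3
  rw [div_mul_eq_mul_div, le_div_iff₀ H.pos_left]
  linarith

end StronglyConvexConcave

/-! ### Parameter bound and main theorem. -/

theorem ParamConditions.mu_le_one {lam L r₁ r₂ c α β μ : ℝ} (hlam : 0 < lam)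
    (h : ParamConditions lam L r₁ r₂ c α β μ) : μ ≤ 1 := by
  refine (h.μ_le.trans (min_le_left _ _)).trans (div_le_one_of_le₀ ?_ (by positivity))
  have : 0 ≤ lam ^ 2 * L ^ 2 := by positivity
  linarith

theorem proposition2 {n d : ℕ}
    (f : EuclideanSpace ℝ (Fin n) → EuclideanSpace ℝ (Fin d) → ℝ)
    (X : Set (EuclideanSpace ℝ (Fin n))) (Y : Set (EuclideanSpace ℝ (Fin d)))
    (hXne : X.Nonempty) (hXconv : Convex ℝ X) (hXcomp : IsCompact X)
    (hYne : Y.Nonempty) (hYconv : Convex ℝ Y) (hYcomp : IsCompact Y)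
    (lam L r₁ r₂ c α β μ : ℝ) (hlam : 0 < lam) (hL : 0 < L)
    (hf : LipschitzGradient f X Y L (lam * L))
    (hpar : ParamConditions lam L r₁ r₂ c α β μ) :
    -- the solution maps are well defined
    (∀ z v, ∃! x, x ∈ X ∧ IsMinOn (fun a => primalVal f Y r₁ r₂ a z v) X x) ∧
    (∀ x ∈ X, ∀ z v, ∃! y, y ∈ Y ∧ IsMaxOn (fun b => regF f r₁ r₂ x b z v) Y y) ∧
    (∀ z, ∃ w, IsVSol f X Y r₁ r₂ z w) ∧
    -- (i) the Kurdyka–Łojasiewicz case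
    (∀ τ θ : ℝ, 0 < τ → 0 < θ → θ < 1 → DualKL f X Y τ θ →
      (∀ z v w, IsVSol f X Y r₁ r₂ z w →
        ‖xSol f X Y r₁ r₂ z (vPlus f X Y r₁ r₂ μ z v) - xSol f X Y r₁ r₂ z w‖ ^ 2
          ≤ omega0 lam L r₁ r₂ μ τ θ * ‖vPlus f X Y r₁ r₂ μ z v - v‖ ^ (1 / θ)) ∧
      (∀ x y z v, IsDSGDA f X Y r₁ r₂ c α β μ x y z v →
        ∀ t w, IsVSol f X Y r₁ r₂ (z (t + 1)) w →
        ‖xSol f X Y r₁ r₂ (z (t + 1)) (vPlus f X Y r₁ r₂ μ (z (t + 1)) (v t))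
            - xSol f X Y r₁ r₂ (z (t + 1)) w‖ ^ 2
          ≤ omega0 lam L r₁ r₂ μ τ θ *
            ‖vPlus f X Y r₁ r₂ μ (z (t + 1)) (v t) - v t‖ ^ (1 / θ))) ∧
    -- (ii) the concave case
    (DualConcave f X Y →
      (∀ z v w, IsVSol f X Y r₁ r₂ z w →
        ‖xSol f X Y r₁ r₂ z (vPlus f X Y r₁ r₂ μ z v) - xSol f X Y r₁ r₂ z w‖ ^ 2
          ≤ omega1 Y lam L r₁ r₂ μ * ‖vPlus f X Y r₁ r₂ μ z v - v‖) ∧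
      (∀ x y z v, IsDSGDA f X Y r₁ r₂ c α β μ x y z v →
        ∀ t w, IsVSol f X Y r₁ r₂ (z (t + 1)) w →
        ‖xSol f X Y r₁ r₂ (z (t + 1)) (vPlus f X Y r₁ r₂ μ (z (t + 1)) (v t))
            - xSol f X Y r₁ r₂ (z (t + 1)) w‖ ^ 2
          ≤ omega1 Y lam L r₁ r₂ μ *
            ‖vPlus f X Y r₁ r₂ μ (z (t + 1)) (v t) - v t‖)) := by
  have hr₁ : L < r₁ := by linarith [hpar.r₁_ge]
  have hM : 0 < lam * L := mul_pos hlam hL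
  have hr₂ : lam * L < r₂ := by linarith [hpar.r₂_ge]
  have hr₂0 : 0 < r₂ := hM.trans hr₂
  have hm₁ : 0 < r₁ - L := sub_pos.2 hr₁
  have hm₂ : 0 < r₂ - lam * L := sub_pos.2 hr₂
  have hμ0 := hpar.μ_pos
  have hμ1 := hpar.mu_le_one hlam
  have H := hf.stronglyConvexConcave hXne hXconv hXcomp hYne hYconv hYcomp hr₁ hr₂
  have hcoef : 0 ≤ (1 - μ) / μ + r₂ / (r₂ - lam * L) :=
    add_nonneg (div_nonneg (sub_nonneg.2 hμ1) hμ0.le) (by positivity)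
  refine ⟨H.existsUnique_isMinOn_primalVal, fun x hx => H.existsUnique_isMaxOn_regF hx,
    H.exists_isVSol hr₂0.le, fun τ θ hτ hθ _ hKL => ?_, fun hconc => ?_⟩
  · have main : ∀ z v w, IsVSol f X Y r₁ r₂ z w →
        ‖xSol f X Y r₁ r₂ z (vPlus f X Y r₁ r₂ μ z v) - xSol f X Y r₁ r₂ z w‖ ^ 2
          ≤ omega0 lam L r₁ r₂ μ τ θ * ‖vPlus f X Y r₁ r₂ μ z v - v‖ ^ (1 / θ) := by
      intro z v w hw
      have h1 := H.norm_xSol_sub_sq_le hr₂0 (v := vPlus f X Y r₁ r₂ μ z v) hw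
        (B := fun s => (r₂ * s / τ) ^ (1 / θ))
        -- The exponent 1/θ is nonzero, so the power vanishes at 0; with exponent 0 it would be 1.
        (by simp [Real.zero_rpow (inv_ne_zero hθ.ne')])
        (fun x hx y hy y' hy' u hmax =>
          hKL.sub_le_rpow_of_isMaxOn_prox hτ hθ hr₂0.le hf hYconv hYcomp hx hy hy' hmax)
      have h2 := H.norm_sub_vPlus_le hr₂0 hμ0 hμ1 z v (H.isRegSaddle_xSol_ySol z _)
      refine h1.trans ?_
      calc _ ≤ 2 / (r₁ - L) * (r₂ * (((1 - μ) / μ + r₂ / (r₂ - lam * L)) *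
              ‖vPlus f X Y r₁ r₂ μ z v - v‖) / τ) ^ (1 / θ) := by
            gcongr
        _ = _ := by
            rw [show r₂ * (((1 - μ) / μ + r₂ / (r₂ - lam * L)) *
                ‖vPlus f X Y r₁ r₂ μ z v - v‖) / τ
              = (r₂ * ((1 - μ) / μ + r₂ / (r₂ - lam * L))) *
                ‖vPlus f X Y r₁ r₂ μ z v - v‖ / τ by ring,
              Real.div_rpow (by positivity) hτ.le, Real.mul_rpow (by positivity) (norm_nonneg _),
              omega0, show r₂ * (1 - μ) / μ + r₂ ^ 2 / (r₂ - lam * L)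
                = r₂ * ((1 - μ) / μ + r₂ / (r₂ - lam * L)) by ring,
              ← div_div]
            ring
    exact ⟨main, fun _ _ z v _ t w hw => main (z (t + 1)) (v t) w hw⟩
  · have main : ∀ z v w, IsVSol f X Y r₁ r₂ z w →
        ‖xSol f X Y r₁ r₂ z (vPlus f X Y r₁ r₂ μ z v) - xSol f X Y r₁ r₂ z w‖ ^ 2
          ≤ omega1 Y lam L r₁ r₂ μ * ‖vPlus f X Y r₁ r₂ μ z v - v‖ := by
      intro z v w hw
      have h1 := H.norm_xSol_sub_sq_le hr₂0 (v := vPlus f X Y r₁ r₂ μ z v) hw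
        (B := fun s => r₂ * s * Metric.diam Y) (by simp)
        (fun x hx y hy y' hy' u hmax =>
          hconc.sub_le_of_isMaxOn_prox hr₂0.le hYcomp hx hy hy' hmax)
      have h2 := H.norm_sub_vPlus_le hr₂0 hμ0 hμ1 z v (H.isRegSaddle_xSol_ySol z _)
      have hdiam : 0 ≤ Metric.diam Y := Metric.diam_nonneg
      refine h1.trans ?_
      calc _ ≤ 2 / (r₁ - L) * (r₂ * (((1 - μ) / μ + r₂ / (r₂ - lam * L)) *
              ‖vPlus f X Y r₁ r₂ μ z v - v‖) * Metric.diam Y) := by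
            gcongr
        -- The argument gives the factor 2; the constant `omega1` carries 4.
        _ ≤ 4 / (r₁ - L) * (r₂ * (((1 - μ) / μ + r₂ / (r₂ - lam * L)) *
              ‖vPlus f X Y r₁ r₂ μ z v - v‖) * Metric.diam Y) := by
            gcongr
            norm_num
        _ = _ := by
            rw [omega1]
            ring
    exact ⟨main, fun _ _ z v _ t w hw => main (z (t + 1)) (v t) w hw⟩
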